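/- Let $A$ be a finite non-empty alphabet and let $\varphi$ be a primitive morphism on $A$, that is, an endomorphism of the free monoid $A^*$ such that for some $n\ge 1$ every letter of $A$ occurs in $\varphi^n(a)$ for every $a\in A$. Let $\mathcal L_\varphi$ be the language generated by $\varphi$: the set of all factors (contiguous subwords, the empty word included) of the words $\varphi^n(a)$, $n\ge 0$, $a\in A$. Let $\mu_\varphi$ be the shift-invariant Borel probability measure on the subshift $X_\varphi$ of all infinite words $x_0x_1x_2\cdots$ over $A$ whose factors all belong to $\mathcal L_\varphi$, and for a letter $a$ write $\mu_\varphi(a)=\mu_\varphi(\{x\in X_\varphi: x_0=a\})$. (This measure exists and is unique, except when $A$ has one letter and $\varphi$ is the identity; then $X_\varphi$ is empty, and this case is excluded.) Let $S:\mathcal L_\varphi\to\mathbb Z\times\mathbb Z$ be a homomorphism, that is, $S(vw)=S(v)+S(w)$ whenever $v$, $w$ and $vw$ belong to $\mathcal L_\varphi$. If the drift $$\Delta_\varphi(S)=\sum_{a\in A}\mu_\varphi(a)\,S(a)$$ is different from $(0,0)$, then the complement $(\mathbb Z\times\mathbb Z)\setminus S(\mathcal L_\varphi)$ is infinite. -/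

import Mathlib

open MeasureTheory

/-- A morphism of the free monoid of words over `A` is primitive if, for some `n ≥ 1`, every letter
occurs in the `n`-th iterate of every letter. -/
def IsPrimitiveMorphism {A : Type*} (φ : FreeMonoid A →* FreeMonoid A) : Prop :=
  ∃ n : ℕ, 1 ≤ n ∧ ∀ a b : A, b ∈ (φ^[n] (FreeMonoid.of a)).toList

/-- The language generated by a morphism `φ`: all factors (contiguous subwords, the empty word
included) of the words `φ^n(a)`, for `n ≥ 0` and `a` a letter. -/
def morphismLanguage {A : Type*} (φ : FreeMonoid A →* FreeMonoid A) : Language A :=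
  {w | ∃ (n : ℕ) (a : A), w <:+: (φ^[n] (FreeMonoid.of a)).toList}

/-- Every letter is a word of the language. -/
theorem letter_mem_morphismLanguage {A : Type*} (φ : FreeMonoid A →* FreeMonoid A) (a : A) :
    [a] ∈ morphismLanguage φ :=
  ⟨0, a, List.infix_rfl⟩

/-- A map `S` from a language `L` to an additive monoid is a homomorphism if `S(vw) = S(v) + S(w)`
whenever the words `v`, `w` and `vw` belong to `L`. -/
def IsLanguageHom {A M : Type*} [AddMonoid M] (L : Language A) (S : {w : List A // w ∈ L} → M) :
    Prop :=
  ∀ (v w : List A) (hv : v ∈ L) (hw : w ∈ L) (hvw : v ++ w ∈ L),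
    S ⟨v ++ w, hvw⟩ = S ⟨v, hv⟩ + S ⟨w, hw⟩

/-- The left shift on infinite words. -/
def wordShift {A : Type*} (x : ℕ → A) : ℕ → A := fun n => x (n + 1)

/-- The subshift of `φ`: the infinite words all of whose factors belong to the language of `φ`. -/
def morphismSubshift {A : Type*} (φ : FreeMonoid A →* FreeMonoid A) : Set (ℕ → A) :=
  {x | ∀ k n : ℕ, List.ofFn (fun i : Fin n => x (k + i)) ∈ morphismLanguage φ}

/-- `μ` is a shift-invariant Borel probability measure on the subshift of `φ`. For a primitive `φ` on
a non-empty finite alphabet, other than the identity on a one-letter alphabet, there is exactly one such measure. -/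
structure IsMorphismMeasure {A : Type*} [MeasurableSpace A] (φ : FreeMonoid A →* FreeMonoid A)
    (μ : Measure (ℕ → A)) : Prop where
  isProbabilityMeasure : IsProbabilityMeasure μ
  shift_invariant : MeasurePreserving wordShift μ μ
  ae_mem_subshift : ∀ᵐ x ∂μ, x ∈ morphismSubshift φ

/-- The set of infinite words that start with the word `w`. -/
def wordCylinder {A : Type*} (w : List A) : Set (ℕ → A) :=
  {x | ∀ i : Fin w.length, x i = w.get i}

/-- The drift of `S`: the sum over the letters `a` of `μ(a) S(a)`, where `μ(a)` is the measure of
the set of infinite words that start with `a`. -/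
noncomputable def drift {A : Type*} [Fintype A] [MeasurableSpace A]
    (φ : FreeMonoid A →* FreeMonoid A) (μ : Measure (ℕ → A))
    (S : {w : List A // w ∈ morphismLanguage φ} → ℤ × ℤ) : ℝ × ℝ :=
  ∑ a : A, μ.real (wordCylinder [a]) •
    (((S ⟨[a], letter_mem_morphismLanguage φ a⟩).1 : ℝ),
      ((S ⟨[a], letter_mem_morphismLanguage φ a⟩).2 : ℝ))

/-! Pair `S` with the drift `d`: `f z = ⟨d, z⟩`. Then `f ∘ S` is a sum of letter weights with mean
`|d|² > 0`. Such a weight grows linearly with word length, so only finitely many words satisfy `f (S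
w) ≤ 0`, while the half-plane `f ≤ 0` contains infinitely many lattice points; almost all of them
are missed.

Linear growth does not use unique ergodicity. By primitivity the averages of the weight over the
`φ^n(a)` eventually lie in a short interval `[c, c + ε]` (`exists_wordWeight_iterWord_near`).
Cutting words into blocks `φ^n(a)` carries both bounds to the whole language up to an additive
constant (`exists_neg_le_wordWeight`), and integrating against `μ` shows that `c + ε` is at least
the mean (`sum_measure_mul_le`). -/

/-- The sum of the weights `s a` over the letters `a` of a word. -/
def wordWeight {A : Type*} (s : A → ℝ) (w : List A) : ℝ := (w.map s).sum

/-- The image of a word under the `n`-th iterate of a morphism. -/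
def iterWord {A : Type*} (φ : FreeMonoid A →* FreeMonoid A) (n : ℕ) (v : List A) : List A :=
  (φ^[n] (FreeMonoid.ofList v)).toList

/-! ### Additive weights and iterates of a morphism -/

section Words

variable {A : Type*} (φ : FreeMonoid A →* FreeMonoid A) (s : A → ℝ)

@[simp] theorem wordWeight_nil : wordWeight s [] = 0 := by simp [wordWeight]

@[simp] theorem wordWeight_cons (a : A) (w : List A) :
    wordWeight s (a :: w) = s a + wordWeight s w := by simp [wordWeight]

@[simp] theorem wordWeight_append (v w : List A) :
    wordWeight s (v ++ w) = wordWeight s v + wordWeight s w := by simp [wordWeight]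

theorem wordWeight_sub_const (c : ℝ) (w : List A) :
    wordWeight (fun a => s a - c) w = wordWeight s w - c * w.length := by
  induction w with
  | nil => simp
  | cons a w ih => simp [ih]; ring

theorem wordWeight_const_sub (c : ℝ) (w : List A) :
    wordWeight (fun a => c - s a) w = c * w.length - wordWeight s w := by
  induction w with
  | nil => simp
  | cons a w ih => simp [ih]; ring

theorem wordWeight_nonneg {s : A → ℝ} (hs : ∀ a, 0 ≤ s a) (w : List A) : 0 ≤ wordWeight s w := by
  induction w with
  | nil => simp
  | cons a w ih => simpa using add_nonneg (hs a) ih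

theorem le_wordWeight_of_mem {s : A → ℝ} (hs : ∀ a, 0 ≤ s a) {w : List A} {b : A} (hb : b ∈ w) :
    s b ≤ wordWeight s w := by
  induction w with
  | nil => simp at hb
  | cons a w ih =>
    rw [wordWeight_cons]
    rcases List.mem_cons.1 hb with rfl | h
    · linarith [wordWeight_nonneg hs w]
    · linarith [ih h, hs a]

theorem abs_wordWeight_le {s : A → ℝ} {T : ℝ} (hT : ∀ a, |s a| ≤ T) (w : List A) :
    |wordWeight s w| ≤ T * w.length := by
  induction w with
  | nil => simp
  | cons a w ih =>
    rw [wordWeight_cons, List.length_cons]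
    push_cast
    linarith [abs_add_le (s a) (wordWeight s w), hT a]

theorem wordWeight_ofFn (n : ℕ) (f : Fin n → A) :
    wordWeight s (List.ofFn f) = ∑ i, s (f i) := by
  simp [wordWeight, List.map_ofFn, List.sum_ofFn]

@[simp] theorem iterWord_nil (n : ℕ) : iterWord φ n [] = [] := by
  have : φ^[n] 1 = 1 := iterate_map_one φ n
  exact congrArg FreeMonoid.toList this

theorem iterWord_append (n : ℕ) (v w : List A) :
    iterWord φ n (v ++ w) = iterWord φ n v ++ iterWord φ n w := by
  simp [iterWord, FreeMonoid.ofList_append, iterate_map_mul, FreeMonoid.toList_mul]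

theorem iterWord_cons (n : ℕ) (a : A) (v : List A) :
    iterWord φ n (a :: v) = iterWord φ n [a] ++ iterWord φ n v :=
  iterWord_append φ n [a] v

theorem iterWord_add (m n : ℕ) (v : List A) :
    iterWord φ (m + n) v = iterWord φ m (iterWord φ n v) := by
  simp [iterWord, Function.iterate_add_apply]

theorem wordWeight_iterWord (n : ℕ) (v : List A) :
    wordWeight s (iterWord φ n v) = wordWeight (fun a => wordWeight s (iterWord φ n [a])) v := by
  induction v with
  | nil => simp
  | cons a v ih => rw [iterWord_cons, wordWeight_append, ih, wordWeight_cons]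

theorem wordWeight_one (w : List A) : wordWeight (fun _ => 1) w = w.length := by
  simp [wordWeight]

theorem wordWeight_iterWord_nonneg_add {n : ℕ}
    (h : ∀ a, 0 ≤ wordWeight s (iterWord φ n [a])) (m : ℕ) (v : List A) :
    0 ≤ wordWeight s (iterWord φ (n + m) v) := by
  rw [iterWord_add, wordWeight_iterWord]
  exact wordWeight_nonneg h _

theorem mem_morphismLanguage_of_infix {v w : List A} (h : v <:+: w)
    (hw : w ∈ morphismLanguage φ) : v ∈ morphismLanguage φ := by
  obtain ⟨n, a, hn⟩ := hw
  exact ⟨n, a, h.trans hn⟩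

end Words

/-! ### Lower bounds on the whole language -/

section Bounds

variable {A : Type*} (φ : FreeMonoid A →* FreeMonoid A)

theorem neg_le_wordWeight_of_prefix_iterWord (s : A → ℝ) {n : ℕ} {K : ℝ} (hK : 0 ≤ K)
    (h : ∀ a, 0 ≤ wordWeight s (iterWord φ n [a]))
    (hinf : ∀ a u, u <:+: iterWord φ n [a] → -K ≤ wordWeight s u)
    (v u : List A) (hu : u <+: iterWord φ n v) : -K ≤ wordWeight s u := by
  induction v generalizing u with
  | nil =>
    rw [iterWord_nil, List.prefix_nil] at hu
    simpa [hu] using hK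
  | cons a v ih =>
    rw [iterWord_cons] at hu
    rcases List.prefix_or_prefix_of_prefix hu (List.prefix_append _ _) with hu' | ⟨p, rfl⟩
    · exact hinf a u hu'.isInfix
    · rw [wordWeight_append]
      linarith [h a, ih p ((List.prefix_append_right_inj _).1 hu)]

/-- Full blocks `φ^n(a)` contribute nonnegatively; only the two partial blocks at the ends can lose,
each at most `K`. -/
theorem neg_le_wordWeight_of_infix_iterWord (s : A → ℝ) {n : ℕ} {K : ℝ} (hK : 0 ≤ K)
    (h : ∀ a, 0 ≤ wordWeight s (iterWord φ n [a]))
    (hinf : ∀ a u, u <:+: iterWord φ n [a] → -K ≤ wordWeight s u)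
    (v u : List A) (hu : u <:+: iterWord φ n v) : -(2 * K) ≤ wordWeight s u := by
  induction v generalizing u with
  | nil =>
    rw [iterWord_nil, List.infix_nil] at hu
    simpa [hu] using hK
  | cons a v ih =>
    rw [iterWord_cons, List.infix_append_iff] at hu
    rcases hu with hu | hu | ⟨p, q, rfl, hp, hq⟩
    · linarith [hinf a u hu]
    · exact ih u hu
    · rw [wordWeight_append]
      linarith [hinf a p hp.isInfix,
        neg_le_wordWeight_of_prefix_iterWord φ s hK h hinf v q hq]

/-- If the images of the letters under some iterate of `φ` have nonnegative weight, then the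
weights of the words of the language are bounded below. -/
theorem exists_neg_le_wordWeight [Fintype A] (s : A → ℝ) {n : ℕ}
    (h : ∀ a, 0 ≤ wordWeight s (iterWord φ n [a])) :
    ∃ K : ℝ, ∀ w ∈ morphismLanguage φ, -K ≤ wordWeight s w := by
  set T : ℝ := ∑ a, |s a|
  have hT : ∀ a, |s a| ≤ T := fun a =>
    Finset.single_le_sum (f := fun a => |s a|) (fun b _ => abs_nonneg _) (Finset.mem_univ a)
  have hT0 : 0 ≤ T := Finset.sum_nonneg fun a _ => abs_nonneg _
  set M : ℕ := ∑ i ∈ Finset.range (n + 1), ∑ a, (iterWord φ i [a]).length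
  have hM : ∀ i ≤ n, ∀ a, (iterWord φ i [a]).length ≤ M := fun i hi a =>
    (Finset.single_le_sum (f := fun a => (iterWord φ i [a]).length) (fun b _ => Nat.zero_le _)
      (Finset.mem_univ a)).trans
    (Finset.single_le_sum (f := fun i => ∑ a, (iterWord φ i [a]).length) (fun b _ => Nat.zero_le _)
      (Finset.mem_range.2 (Nat.lt_succ_of_le hi)))
  have hK : 0 ≤ T * M := by positivity
  have hinf : ∀ i ≤ n, ∀ a u, u <:+: iterWord φ i [a] → -(T * M) ≤ wordWeight s u := by
    intro i hi a u hu
    have h1 : (u.length : ℝ) ≤ M := by exact_mod_cast hu.length_le.trans (hM i hi a)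
    have h2 := mul_le_mul_of_nonneg_left h1 hT0
    linarith [neg_abs_le (wordWeight s u), abs_wordWeight_le hT u]
  refine ⟨2 * (T * M), ?_⟩
  rintro w ⟨N, a, hw⟩
  change w <:+: iterWord φ N [a] at hw
  rcases le_total N n with hN | hN
  · linarith [hinf N hN a w hw]
  · obtain ⟨m, rfl⟩ := Nat.exists_eq_add_of_le hN
    rw [iterWord_add] at hw
    exact neg_le_wordWeight_of_infix_iterWord φ s hK h (hinf n le_rfl) _ w hw

end Bounds

/-! ### Contraction of the block averages -/

section Contraction

variable {A : Type*} [Fintype A] (φ : FreeMonoid A →* FreeMonoid A)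

/-- Since `φ^k(b)` contains every letter `c`, no block `φ^m(c)` is longer than `φ^(k+m)(b)`, and
`φ^(k+m+k)(a)` consists of `|φ^(2k)(a)|` such blocks. Hence `C` does not depend on `m`. -/
theorem exists_length_iterWord_le {k : ℕ} (hk : ∀ a b, b ∈ iterWord φ k [a]) :
    ∃ C : ℝ, 1 ≤ C ∧ ∀ m a b,
      ((iterWord φ (k + m + k) [a]).length : ℝ) ≤ C * (iterWord φ (k + m) [b]).length := by
  refine ⟨1 + ∑ a, ((iterWord φ (k + k) [a]).length : ℝ), ?_, fun m a b => ?_⟩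
  · have : 0 ≤ ∑ a, ((iterWord φ (k + k) [a]).length : ℝ) := by positivity
    linarith
  · set l : ℝ := ((iterWord φ (k + m) [b]).length : ℝ) with hl
    have hlc : ∀ c, wordWeight (fun _ => 1) (iterWord φ m [c]) ≤ l := fun c => by
      rw [hl, add_comm k m, iterWord_add, ← wordWeight_one (iterWord φ m _),
        wordWeight_iterWord φ _ m (iterWord φ k [b])]
      exact le_wordWeight_of_mem (s := fun a => wordWeight (fun _ => 1) (iterWord φ m [a]))
        (fun a => wordWeight_nonneg (fun _ => zero_le_one) _) (hk b c)
    have h1 : ((iterWord φ (k + m + k) [a]).length : ℝ) ≤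
        l * (iterWord φ (k + k) [a]).length := by
      rw [show k + m + k = m + (k + k) by omega, iterWord_add, ← wordWeight_one (iterWord φ m _),
        wordWeight_iterWord]
      refine (le_abs_self _).trans (abs_wordWeight_le (fun c => ?_) _)
      rw [abs_of_nonneg (wordWeight_nonneg (fun _ => zero_le_one) _)]
      exact hlc c
    have h2 : ((iterWord φ (k + k) [a]).length : ℝ) ≤
        1 + ∑ a, ((iterWord φ (k + k) [a]).length : ℝ) := by
      have := Finset.single_le_sum (f := fun a => ((iterWord φ (k + k) [a]).length : ℝ))
        (fun b _ => Nat.cast_nonneg _) (Finset.mem_univ a)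
      linarith
    calc _ ≤ _ := h1
      _ ≤ l * (1 + ∑ a, ((iterWord φ (k + k) [a]).length : ℝ)) :=
        mul_le_mul_of_nonneg_left h2 (Nat.cast_nonneg _)
      _ = _ := mul_comm _ _

/-- The average weights of the words `φ^n(a)` get uniformly close to each other. -/
theorem exists_wordWeight_iterWord_near (hφ : IsPrimitiveMorphism φ) (s : A → ℝ) {ε : ℝ}
    (hε : 0 < ε) :
    ∃ (n : ℕ) (c : ℝ), ∀ a, c * (iterWord φ n [a]).length ≤ wordWeight s (iterWord φ n [a]) ∧
      wordWeight s (iterWord φ n [a]) ≤ (c + ε) * (iterWord φ n [a]).length := by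
  obtain ⟨k, -, hk⟩ := hφ
  replace hk : ∀ a b, b ∈ iterWord φ k [a] := hk
  obtain ⟨C, hC1, hC⟩ := exists_length_iterWord_le φ hk
  set δ : ℝ := 1 / (2 * C) with hδ
  have hC0 : 0 < C := by linarith
  have hδ0 : 0 < δ := by positivity
  have hδ1 : δ ≤ 1 / 2 := by
    rw [hδ, div_le_div_iff₀ (by positivity) (by norm_num)]; linarith
  set T : ℝ := 1 + ∑ a, |s a|
  have hT : ∀ a, |s a| ≤ T := fun a => by
    have := Finset.single_le_sum (f := fun a => |s a|) (fun b _ => abs_nonneg _)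
      (Finset.mem_univ a)
    linarith
  have hT0 : 0 < T := by
    have : 0 ≤ ∑ a, |s a| := Finset.sum_nonneg fun a _ => abs_nonneg _
    linarith
  have key : ∀ j : ℕ, ∃ (m : ℕ) (c : ℝ), ∀ a,
      c * (iterWord φ (k + m) [a]).length ≤ wordWeight s (iterWord φ (k + m) [a]) ∧
      wordWeight s (iterWord φ (k + m) [a]) ≤
        (c + (1 - δ) ^ j * (2 * T)) * (iterWord φ (k + m) [a]).length := by
    intro j
    induction j with
    | zero =>
      refine ⟨0, -T, fun a => ?_⟩
      have := abs_le.1 (abs_wordWeight_le hT (iterWord φ (k + 0) [a]))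
      constructor <;> linarith [this.1, this.2]
    | succ j ih =>
      obtain ⟨m, c, h⟩ := ih
      set W : ℝ := (1 - δ) ^ j * (2 * T) with hW
      have hW0 : 0 < W := by
        have : 0 < 1 - δ := by linarith
        positivity
      rw [pow_succ, mul_right_comm, ← hW]
      -- If the average over some `φ^(k+m)(b)` reaches the midpoint, every `φ^(k+m+k)(a)` contains
      -- that block, with at least `1/C` of its length, so the lower end rises by `W / (2C) = W *
      -- δ`. Otherwise the upper end drops to the midpoint, which suffices as `δ ≤ 1/2`.
      by_cases hb : ∃ b, (c + W / 2) * (iterWord φ (k + m) [b]).length ≤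
          wordWeight s (iterWord φ (k + m) [b])
      · obtain ⟨b, hb⟩ := hb
        refine ⟨m + k, c + W * δ, fun a => ⟨?_, ?_⟩⟩
        · have h0 : ∀ a, 0 ≤ wordWeight (fun a => s a - c) (iterWord φ (k + m) [a]) := fun a => by
            rw [wordWeight_sub_const]; linarith [(h a).1]
          have h1 := le_wordWeight_of_mem h0 (hk a b)
          rw [← wordWeight_iterWord, ← iterWord_add, wordWeight_sub_const,
            wordWeight_sub_const] at h1
          have h2 := mul_le_mul_of_nonneg_left (hC m a b) (by positivity : 0 ≤ W * δ)
          have h3 : W * δ * (C * (iterWord φ (k + m) [b]).length) =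
              W / 2 * (iterWord φ (k + m) [b]).length := by
            rw [hδ]; field_simp
          rw [← add_assoc]
          linarith
        · have h0 : ∀ a, 0 ≤ wordWeight (fun a => (c + W) - s a) (iterWord φ (k + m) [a]) :=
            fun a => by rw [wordWeight_const_sub]; linarith [(h a).2]
          have h1 := wordWeight_iterWord_nonneg_add φ _ h0 k [a]
          rw [wordWeight_const_sub] at h1
          rw [← add_assoc, show c + W * δ + W * (1 - δ) = c + W by ring]
          linarith
      · push Not at hb
        refine ⟨m, c, fun a => ⟨(h a).1, (hb a).le.trans ?_⟩⟩
        refine mul_le_mul_of_nonneg_right ?_ (Nat.cast_nonneg _)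
        nlinarith
  obtain ⟨j, hj⟩ := exists_pow_lt_of_lt_one (show 0 < ε / (2 * T) by positivity)
    (show 1 - δ < 1 by linarith)
  obtain ⟨m, c, h⟩ := key j
  refine ⟨k + m, c, fun a => ⟨(h a).1, (h a).2.trans ?_⟩⟩
  refine mul_le_mul_of_nonneg_right ?_ (Nat.cast_nonneg _)
  rw [lt_div_iff₀ (by positivity)] at hj
  linarith

end Contraction

/-! ### Comparison with the invariant measure -/

section Measure

variable {A : Type*} [Fintype A] [MeasurableSpace A] [DiscreteMeasurableSpace A]
  {φ : FreeMonoid A →* FreeMonoid A} {μ : Measure (ℕ → A)}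

theorem wordShift_iterate_apply_zero {A : Type*} (n : ℕ) (x : ℕ → A) : wordShift^[n] x 0 = x n := by
  have : ∀ i, wordShift^[n] x i = x (i + n) := by
    induction n generalizing x with
    | zero => intro i; rfl
    | succ n ih =>
      intro i
      rw [Function.iterate_succ_apply, ih]
      exact congrArg x (by omega)
  simpa using this 0

theorem integrable_letter_weight [IsFiniteMeasure μ] (s : A → ℝ) (n : ℕ) :
    Integrable (fun x : ℕ → A => s (x n)) μ := by
  refine Integrable.of_bound
    ((measurable_of_finite s).comp (measurable_pi_apply n)).aestronglyMeasurable (∑ a, |s a|) ?_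
  refine Filter.Eventually.of_forall fun x => ?_
  exact Finset.single_le_sum (f := fun a => |s a|) (fun b _ => abs_nonneg _)
    (Finset.mem_univ (x n))

theorem integral_letter_weight [IsFiniteMeasure μ] (s : A → ℝ) :
    ∫ x, s (x 0) ∂μ = ∑ a, μ.real (wordCylinder [a]) * s a := by
  have h0 : Measurable fun x : ℕ → A => x 0 := measurable_pi_apply 0
  rw [← integral_map (φ := fun x : ℕ → A => x 0) (f := s) h0.aemeasurable
    (measurable_of_finite s).aestronglyMeasurable, integral_fintype .of_finite]
  refine Finset.sum_congr rfl fun a _ => ?_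
  rw [map_measureReal_apply h0 (measurableSet_singleton a), smul_eq_mul]
  congr 2
  ext x
  simp [wordCylinder]

theorem integral_letter_weight_eq (hμ : IsMorphismMeasure φ μ) (s : A → ℝ) (n : ℕ) :
    ∫ x, s (x n) ∂μ = ∫ x, s (x 0) ∂μ := by
  have hp := hμ.shift_invariant.iterate n
  have h0 : Measurable fun x : ℕ → A => s (x 0) :=
    (measurable_of_finite s).comp (measurable_pi_apply 0)
  conv_rhs => rw [← hp.map_eq, integral_map hp.measurable.aemeasurable h0.aestronglyMeasurable]
  simp only [wordShift_iterate_apply_zero]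

/-- A linear upper bound for the weights of the words of the language is an upper bound for the
mean weight of a letter. -/
theorem sum_measure_mul_le (hμ : IsMorphismMeasure φ μ) (s : A → ℝ) {c K : ℝ}
    (h : ∀ w ∈ morphismLanguage φ, wordWeight s w ≤ c * w.length + K) :
    ∑ a, μ.real (wordCylinder [a]) * s a ≤ c := by
  have := hμ.isProbabilityMeasure
  rw [← integral_letter_weight]
  set I := ∫ x, s (x 0) ∂μ with hI
  -- By invariance the first `N` letters have expected weight `N * I`; letting `N` grow removes `K`.
  have hN : ∀ N : ℕ, N * (I - c) ≤ K := by
    intro N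
    have h1 : ∫ x, ∑ i : Fin N, s (x i) ∂μ = N * I := by
      rw [integral_finsetSum _ fun i _ => integrable_letter_weight s _]
      simp [integral_letter_weight_eq hμ, ← hI]
    have h2 : ∫ x, ∑ i : Fin N, s (x i) ∂μ ≤ ∫ _, (c * N + K) ∂μ := by
      refine integral_mono_ae (integrable_finsetSum _ fun i _ => integrable_letter_weight s _)
        (integrable_const _) ?_
      filter_upwards [hμ.ae_mem_subshift] with x hx
      have := h _ (hx 0 N)
      rw [wordWeight_ofFn, List.length_ofFn] at this
      simpa using this
    rw [h1] at h2
    simp only [integral_const, probReal_univ, one_smul] at h2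
    linarith
  by_contra! hlt
  obtain ⟨N, hN'⟩ := exists_nat_gt (K / (I - c))
  rw [div_lt_iff₀ (by linarith)] at hN'
  linarith [hN N]

/-- If the mean weight of a letter is positive, then only finitely many words of the language
have weight at most zero. -/
theorem finite_wordWeight_nonpos (hφ : IsPrimitiveMorphism φ) (hμ : IsMorphismMeasure φ μ)
    (s : A → ℝ) (hs : 0 < ∑ a, μ.real (wordCylinder [a]) * s a) :
    {w | w ∈ morphismLanguage φ ∧ wordWeight s w ≤ 0}.Finite := by
  set I := ∑ a, μ.real (wordCylinder [a]) * s a with hI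
  obtain ⟨n, c, hn⟩ := exists_wordWeight_iterWord_near φ hφ s (half_pos hs)
  obtain ⟨K₁, hK₁⟩ := exists_neg_le_wordWeight φ (fun a => s a - c) (n := n) fun a => by
    rw [wordWeight_sub_const]; linarith [(hn a).1]
  obtain ⟨K₂, hK₂⟩ := exists_neg_le_wordWeight φ (fun a => (c + I / 2) - s a) (n := n) fun a => by
    rw [wordWeight_const_sub]; linarith [(hn a).2]
  -- The interval `[c, c + I / 2]` cannot lie wholly below the mean `I`, so `c ≥ I / 2 > 0`.
  have hc : I ≤ c + I / 2 := sum_measure_mul_le hμ s (K := K₂) fun w hw => by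
    have := hK₂ w hw
    rw [wordWeight_const_sub] at this
    linarith
  have hc0 : 0 < c := by linarith
  obtain ⟨M, hM⟩ := exists_nat_ge (K₁ / c)
  refine (List.finite_length_le A M).subset ?_
  rintro w ⟨hw, hw0⟩
  have h1 := hK₁ w hw
  rw [wordWeight_sub_const] at h1
  have h2 : (w.length : ℝ) ≤ K₁ / c := by
    rw [le_div_iff₀ hc0]; linarith
  exact Nat.cast_le.1 (h2.trans hM)

end Measure

/-! ### Projection of the homomorphism along the drift -/

theorem IsLanguageHom.weight_eq {A : Type*} {φ : FreeMonoid A →* FreeMonoid A}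
    {S : {w : List A // w ∈ morphismLanguage φ} → ℤ × ℤ}
    (hS : IsLanguageHom (morphismLanguage φ) S) (f : ℤ × ℤ →+ ℝ) (w : List A)
    (hw : w ∈ morphismLanguage φ) :
    f (S ⟨w, hw⟩) = wordWeight (fun a => f (S ⟨[a], letter_mem_morphismLanguage φ a⟩)) w := by
  induction w with
  | nil =>
    have h : S ⟨[], hw⟩ = S ⟨[], hw⟩ + S ⟨[], hw⟩ := hS [] [] hw hw hw
    simp [left_eq_add.1 h]
  | cons a w ih =>
    have hw' := mem_morphismLanguage_of_infix φ (List.suffix_cons a w).isInfix hw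
    have h : S ⟨a :: w, hw⟩ = _ := hS [a] w (letter_mem_morphismLanguage φ a) hw' hw
    rw [h, map_add, ih hw', wordWeight_cons]

theorem infinite_setOf_nonpos (f : ℤ × ℤ →+ ℝ) : {z | f z ≤ 0}.Infinite := by
  have key : ∀ z : ℤ × ℤ, z ≠ 0 → f z ≤ 0 → {z | f z ≤ 0}.Infinite := by
    intro z hz hfz
    refine Set.infinite_of_injective_forall_mem (f := fun n : ℕ => n • z)
      (fun m n h => ?_) fun n => ?_
    · have h' : (m : ℤ) • z = (n : ℤ) • z := by simpa only [natCast_zsmul] using h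
      exact_mod_cast smul_left_injective ℤ hz h'
    · rw [Set.mem_ofPred_eq, map_nsmul, nsmul_eq_mul]
      exact mul_nonpos_of_nonneg_of_nonpos (Nat.cast_nonneg n) hfz
  rcases le_total (f (1, 0)) 0 with h | h
  · exact key (1, 0) (by simp) h
  · exact key (-(1, 0)) (by simp) (by rw [map_neg]; linarith)

theorem proposition2 {A : Type*} [Fintype A] [MeasurableSpace A] [DiscreteMeasurableSpace A]
    (φ : FreeMonoid A →* FreeMonoid A) (hφ : IsPrimitiveMorphism φ)
    (μ : Measure (ℕ → A)) (hμ : IsMorphismMeasure φ μ)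
    (S : {w : List A // w ∈ morphismLanguage φ} → ℤ × ℤ)
    (hS : IsLanguageHom (morphismLanguage φ) S)
    (hdrift : drift φ μ S ≠ 0) :
    ((Set.range S)ᶜ : Set (ℤ × ℤ)).Infinite := by
  set d := drift φ μ S with hd
  let f : ℤ × ℤ →+ ℝ :=
    { toFun := fun z => d.1 * z.1 + d.2 * z.2
      map_zero' := by simp
      map_add' := fun x y => by simp; ring }
  have hf : ∀ z, f z = d.1 * z.1 + d.2 * z.2 := fun z => rfl
  set s : A → ℝ := fun a => f (S ⟨[a], letter_mem_morphismLanguage φ a⟩) with hs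
  have hmean : ∑ a, μ.real (wordCylinder [a]) * s a = d.1 * d.1 + d.2 * d.2 := by
    have h1 : d.1 = ∑ a, μ.real (wordCylinder [a]) *
        ((S ⟨[a], letter_mem_morphismLanguage φ a⟩).1 : ℝ) := by
      rw [hd, drift, Prod.fst_sum]; rfl
    have h2 : d.2 = ∑ a, μ.real (wordCylinder [a]) *
        ((S ⟨[a], letter_mem_morphismLanguage φ a⟩).2 : ℝ) := by
      rw [hd, drift, Prod.snd_sum]; rfl
    refine Eq.trans ?_ (congrArg₂ (fun x y => d.1 * x + d.2 * y) h1 h2).symm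
    simp only [Finset.mul_sum, ← Finset.sum_add_distrib]
    refine Finset.sum_congr rfl fun a _ => ?_
    rw [hs]
    simp only [hf]
    ring
  have hpos : 0 < ∑ a, μ.real (wordCylinder [a]) * s a := by
    rw [hmean]
    have : d.1 ≠ 0 ∨ d.2 ≠ 0 := by
      by_contra! h
      exact hdrift (Prod.ext h.1 h.2)
    rcases this with h | h
    · linarith [mul_self_pos.2 h, mul_self_nonneg d.2]
    · linarith [mul_self_pos.2 h, mul_self_nonneg d.1]
  have hfin := finite_wordWeight_nonpos hφ hμ s hpos
  intro hcompl
  -- A finite complement would make the half-plane finite: its points are either missed by `S` or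
  -- images of the finitely many words of nonpositive weight.
  refine infinite_setOf_nonpos f ((hcompl.union
    ((hfin.preimage Subtype.val_injective.injOn).image S)).subset fun z hz => ?_)
  by_cases hzS : z ∈ Set.range S
  · obtain ⟨⟨w, hw⟩, rfl⟩ := hzS
    refine Or.inr ⟨⟨w, hw⟩, ⟨hw, ?_⟩, rfl⟩
    rw [← hS.weight_eq f w hw]
    exact hz
  · exact Or.inl hzS
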